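/- Let $V$ be a $\mathbb{Q}[\operatorname{SL}_2(\mathbb{Q})]$-module (of arbitrary dimension), where $\operatorname{SL}_2(\mathbb{Q})$ is regarded as an abstract group. Suppose that there is a unipotent element $u \in \operatorname{SL}_2(\mathbb{Q})$, $u \neq 1$, such that $(u-1)^5 = 0$ in $\operatorname{End} V$. Then $V$ has a finite series of $\mathbb{Q}[\operatorname{SL}_2(\mathbb{Q})]$-submodules $$0 = V_0 < V_1 < \dots < V_m = V$$ such that for every $i \in \{1, \dots, m\}$ there are an integer $k \in \{0, \dots, 4\}$ and a (possibly infinite) set $I$ for which $$V_i/V_{i-1} \simeq \bigoplus_{I} \operatorname{Sym}^k \operatorname{Nat} \operatorname{SL}_2(\mathbb{Q})$$ as $\mathbb{Q}[\operatorname{SL}_2(\mathbb{Q})]$-modules. Here $\operatorname{Nat} \operatorname{SL}_2(\mathbb{Q})$ is the natural module $\mathbb{Q}^2$, and its $k$-th symmetric power $\operatorname{Sym}^k \operatorname{Nat} \operatorname{SL}_2(\mathbb{Q})$ is the $(k+1)$-dimensional space of homogeneous polynomials of degree $k$ in $\mathbb{Q}[X, Y]$, on which $\operatorname{SL}_2(\mathbb{Q})$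 acts by linear substitution of the variables ($X$, $Y$ being the standard basis of $\mathbb{Q}^2$). -/

import Mathlib

open scoped MonoidAlgebra DirectSum MatrixGroups

universe v

noncomputable section

namespace SL2Mod

/-- The group ring `ℚ[SL₂(ℚ)]`. -/
abbrev QG : Type := ℚ[SL(2, ℚ)]

/-- An element `u` of `SL₂(ℚ)` is unipotent if `u - 1` is a nilpotent matrix. -/
def IsUnipotent (u : SL(2, ℚ)) : Prop :=
  IsNilpotent ((u : Matrix (Fin 2) (Fin 2) ℚ) - 1)

/-- The linear substitution attached to `g`: the variables `X 0 = X`, `X 1 = Y` form the standard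
basis of the natural module `ℚ²`, so that `X j` is sent to `g • e_j = ∑ i, g i j • e_i`. -/
def subst (g : SL(2, ℚ)) : MvPolynomial (Fin 2) ℚ →ₐ[ℚ] MvPolynomial (Fin 2) ℚ :=
  MvPolynomial.aeval fun j => ∑ i, g.1 i j • MvPolynomial.X i

lemma subst_X (g : SL(2, ℚ)) (j : Fin 2) :
    subst g (MvPolynomial.X j) = ∑ i, g.1 i j • MvPolynomial.X i :=
  MvPolynomial.aeval_X _ j

lemma subst_one : subst 1 = AlgHom.id ℚ _ := by
  apply MvPolynomial.algHom_ext
  intro j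
  rw [subst_X]
  fin_cases j <;> simp [Fin.sum_univ_two]

lemma subst_mul (g h : SL(2, ℚ)) : subst (g * h) = (subst g).comp (subst h) := by
  apply MvPolynomial.algHom_ext
  intro j
  simp only [AlgHom.comp_apply, subst_X, Fin.sum_univ_two, map_add, map_smul,
    Matrix.SpecialLinearGroup.coe_mul, Matrix.mul_apply]
  module

lemma subst_mem (g : SL(2, ℚ)) (k : ℕ) {p : MvPolynomial (Fin 2) ℚ}
    (hp : p ∈ MvPolynomial.homogeneousSubmodule (Fin 2) ℚ k) :
    subst g p ∈ MvPolynomial.homogeneousSubmodule (Fin 2) ℚ k := by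
  rw [MvPolynomial.mem_homogeneousSubmodule] at hp ⊢
  have h := hp.aeval (S := ℚ) (fun j => ∑ i, g.1 i j • MvPolynomial.X i) (n := 1)
    (fun j => MvPolynomial.IsHomogeneous.sum _ _ _ fun i _ =>
      (MvPolynomial.homogeneousSubmodule (Fin 2) ℚ 1).smul_mem _
        (MvPolynomial.isHomogeneous_X ℚ i))
  rwa [one_mul] at h

/-- The representation `Sym^k Nat SL₂(ℚ)`: the space of homogeneous polynomials of degree `k` in
two variables over `ℚ`, with `SL₂(ℚ)` acting by linear substitutions. -/
def symNatRep (k : ℕ) :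
    Representation ℚ SL(2, ℚ) (MvPolynomial.homogeneousSubmodule (Fin 2) ℚ k) where
  toFun g := (subst g).toLinearMap.restrict fun _ hp => subst_mem g k hp
  map_one' := by
    ext p
    simp [subst_one]
  map_mul' g h := by
    refine LinearMap.ext fun p => Subtype.ext ?_
    exact DFunLike.congr_fun (subst_mul g h) p.1

/-- `Sym^k Nat SL₂(ℚ)` as a `ℚ[SL₂(ℚ)]`-module. -/
abbrev SymNat (k : ℕ) : Type := (symNatRep k).asModule

/-- The successive factor `B / (A ∩ B)` of two submodules (this is `B / A` when `A ≤ B`). -/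
abbrev Factor {V : Type*} [AddCommGroup V] [Module QG V] (A B : Submodule QG V) : Type _ :=
  B ⧸ A.submoduleOf B

end SL2Mod

end

/-! The group action determines enough of an `sl₂`-action to run highest weight theory. Up to
conjugation `u` is some `upper a` with `a ≠ 0`. Powers, inverses and torus conjugates make every
`upper b` unipotent of order five, so the root subgroups act as `exp (a x)` and `exp (b y)` with `x
^ 5 = y ^ 5 = 0` (`exists_isLogPair`). The torus is a product of root elements and a Weyl element,
hence acts by Laurent polynomials, and `V` is the sum of its integral weight spaces
(`iSup_weightSpace`).

The commutator of `x` and `y` is never computed. Instead, the relation `lower_eq`, applied to a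
vector `p` of weight `K ≥ 0` killed by `x`, expresses `y ^ l p` through `x ^ (K - l)` of the Weyl
translate of `p` (`lower_highest`). Hence `p = 0` if `K ≥ 5`, and `x ^ j y ^ j p` is a nonzero
multiple of `p` for `j ≤ K`. It follows that such vectors generate `V` (`eq_top_of_highest`). For `K
≤ 4`, an equivariant map from the simple module `SymNat K` sends `X ^ K` to `K! • p`
(`symMap_equivariant`). So `V` is the sum of five isotypic components, and their partial sums form
the series (`exists_series`). -/

namespace SL2Mod

open Finset

/-! ### Truncated exponential and logarithm. -/

section Unipotent

open Polynomial

variable {A : Type*} [Ring A] [Algebra ℚ A]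

/-- The logarithm, truncated at order five, of `1 + n`. -/
def logFive (n : A) : A :=
  n - (1 / 2 : ℚ) • n ^ 2 + (1 / 3 : ℚ) • n ^ 3 - (1 / 4 : ℚ) • n ^ 4

/-- The exponential series truncated at order five. -/
def expFive (x : A) : A := ∑ l ∈ range 5, (1 / (l.factorial : ℚ)) • x ^ l

lemma expFive_eq (x : A) : expFive x =
    1 + x + (1 / 2 : ℚ) • x ^ 2 + (1 / 6 : ℚ) • x ^ 3 + (1 / 24 : ℚ) • x ^ 4 := by
  simp [expFive, sum_range_succ, Nat.factorial]

lemma expFive_eq_exp {x : A} (h : x ^ 5 = 0) : expFive x = IsNilpotent.exp x := by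
  simp [expFive, IsNilpotent.exp_eq_sum h]

lemma map_expFive {B : Type*} [Ring B] [Algebra ℚ B] (f : A →ₐ[ℚ] B) (x : A) :
    f (expFive x) = expFive (f x) := by
  simp [expFive]

lemma map_logFive {B : Type*} [Ring B] [Algebra ℚ B] (f : A →ₐ[ℚ] B) (x : A) :
    f (logFive x) = logFive (f x) := by
  simp [logFive]

/-- In `ℚ[X]` the composite is `1 + X` modulo `X ^ 5`. The listed coefficients are the cofactor of
`X ^ 5`, and evaluation at `n` kills that term. `logFive_expFive` works the same way. -/
lemma expFive_logFive {n : A} (h : n ^ 5 = 0) : expFive (logFive n) = 1 + n := by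
  have key : expFive (logFive (X : ℚ[X])) = 1 + X + X ^ 5 *
      (C (-5/24) + C (-1/72) * X^1 + C (-1/144) * X^2 + C (3/128) * X^3 + C (-37/1296) * X^4
        + C (239/5184) * X^5 + C (-169/5184) * X^6 + C (1193/62208) * X^7 + C (-97/10368) * X^8
        + C (7/2304) * X^9 + C (-1/1152) * X^10 + C (1/6144) * X^11) := by
    refine Polynomial.funext fun q => ?_
    simp only [expFive_eq, logFive, eval_add, eval_sub, eval_smul, eval_pow, eval_mul, eval_X,
      eval_C, eval_one, smul_eq_mul]
    ring
  have := congrArg (aeval n) key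
  rw [map_expFive, map_logFive, aeval_X, map_add, map_mul, map_pow, aeval_X, h] at this
  simpa using this

lemma logFive_expFive {x : A} (h : x ^ 5 = 0) : logFive (expFive x - 1) = x := by
  have key : logFive (expFive (X : ℚ[X]) - 1) = X + X ^ 5 *
      (C (-5/24) + C (-47/144) * X^1 + C (-5/16) * X^2 + C (-239/1152) * X^3 + C (-541/5184) * X^4
        + C (-1/24) * X^5 + C (-23/1728) * X^6 + C (-71/20736) * X^7 + C (-29/41472) * X^8
        + C (-1/9216) * X^9 + C (-1/82944) * X^10 + C (-1/1327104) * X^11) := by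
    refine Polynomial.funext fun q => ?_
    simp only [expFive_eq, logFive, eval_add, eval_sub, eval_smul, eval_pow, eval_mul, eval_X,
      eval_C, eval_one, smul_eq_mul]
    ring
  have := congrArg (aeval x) key
  rw [map_logFive, map_sub, map_expFive, map_add, map_mul, map_pow, aeval_X, h] at this
  simpa using this

lemma logFive_pow {n : A} (h : n ^ 5 = 0) : logFive n ^ 5 = 0 := by
  have key : logFive (X : ℚ[X]) = X * (1 - (1 / 2 : ℚ) • X + (1 / 3 : ℚ) • X ^ 2
      - (1 / 4 : ℚ) • X ^ 3) := by
    refine Polynomial.funext fun q => ?_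
    simp only [logFive, eval_add, eval_sub, eval_smul, eval_pow, eval_mul, eval_X, eval_one,
      smul_eq_mul]
    ring
  have := congrArg (aeval n) (congrArg (· ^ 5) key)
  simp only [mul_pow, map_pow, map_mul, aeval_X, h, zero_mul, map_logFive] at this
  exact this

lemma expFive_nsmul {x : A} (h : x ^ 5 = 0) (n : ℕ) : expFive (n • x) = expFive x ^ n := by
  have hn : ∀ n : ℕ, (n • x) ^ 5 = 0 := fun n => by
    rw [_root_.smul_pow, h, smul_zero]
  induction n with
  | zero => simp [expFive_eq]
  | succ n ih =>
    rw [pow_succ, ← ih, expFive_eq_exp h, expFive_eq_exp (hn _), expFive_eq_exp (hn _), succ_nsmul,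
      IsNilpotent.exp_add_of_commute ((Commute.refl x).smul_left n) ⟨5, hn n⟩ ⟨5, h⟩]

lemma expFive_neg_mul {x : A} (h : x ^ 5 = 0) : expFive (-x) * expFive x = 1 := by
  have h' : (-x) ^ 5 = 0 := by rw [neg_pow, h, mul_zero]
  rw [expFive_eq_exp h, expFive_eq_exp h', IsNilpotent.exp_neg_mul_exp_self ⟨5, h⟩]

/-- A homomorphism from the additive group of `ℚ` to an algebra, with all values unipotent of
order five, is of the form `a ↦ exp (a x)`. -/
lemma exists_expFive (f : Multiplicative ℚ →* A)
    (hf : ∀ a, (f a - 1) ^ 5 = 0) (a : ℚ) :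
    f (.ofAdd a) = expFive (a • logFive (f (.ofAdd 1) - 1)) := by
  set L : ℚ → A := fun a => logFive (f (.ofAdd a) - 1) with hL
  have hL5 : ∀ a, L a ^ 5 = 0 := fun a => logFive_pow (hf _)
  have hE : ∀ a, expFive (L a) = f (.ofAdd a) := fun a => by
    rw [hL, expFive_logFive (hf _), add_sub_cancel]
  -- Nilpotent logarithms are unique, so `L` commutes with integer multiples; clearing denominators
  -- then makes it `ℚ`-linear.
  have uniq : ∀ {a x}, x ^ 5 = 0 → expFive x = f (.ofAdd a) → L a = x := fun {a x} hx h => by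
    rw [hL]; simp only [← h]; exact logFive_expFive hx
  have hn : ∀ (n : ℕ) a, L (n • a) = n • L a := fun n a => by
    apply uniq
    · rw [_root_.smul_pow, hL5, smul_zero]
    · rw [expFive_nsmul (hL5 a), hE, ← map_pow, ← ofAdd_nsmul]
  have hneg : ∀ a, L (-a) = - L a := fun a => by
    apply uniq
    · rw [neg_pow, hL5, mul_zero]
    · have h1 := expFive_neg_mul (hL5 a)
      have h2 : expFive (L a) * expFive (L (-a)) = 1 := by
        rw [hE, hE, ← map_mul, ← ofAdd_add, add_neg_cancel, ofAdd_zero, map_one]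
      rw [← hE]
      exact left_inv_eq_right_inv h1 h2
  have hz : ∀ (n : ℤ) a, L (n • a) = n • L a := fun n a => by
    obtain ⟨m, rfl | rfl⟩ := n.eq_nat_or_neg
    · simpa using hn m a
    · simpa [hneg] using hn m a
  have hq : L a = a • L 1 := by
    have h1 : (a.den : ℚ) • L a = (a.num : ℚ) • L 1 := by
      rw [Nat.cast_smul_eq_nsmul, Int.cast_smul_eq_zsmul, ← hn, ← hz]
      congr 1
      simp [mul_comm, Rat.mul_den_eq_num]
    have h2 : (a.den : ℚ) ≠ 0 := by exact_mod_cast a.den_ne_zero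
    rw [← inv_smul_smul₀ h2 (L a), h1, smul_smul]
    congr 1
    rw [mul_comm, ← div_eq_mul_inv, Rat.num_div_den]
  rw [← hE, hq]

end Unipotent

/-! ### Vanishing of vector-valued polynomials and Laurent polynomials. -/

section Independence

open Polynomial

variable {M : Type*} [AddCommGroup M] [Module ℚ M]

/-- A polynomial with vector coefficients vanishing on an infinite set has zero coefficients. -/
lemma coeff_eq_zero_of_infinite {s : Set ℚ} (hs : s.Infinite) (n : ℕ) (m : ℕ → M)
    (h : ∀ c ∈ s, ∑ l ∈ range n, c ^ l • m l = 0) {l : ℕ} (hl : l < n) : m l = 0 := by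
  rw [← Module.forall_dual_apply_eq_zero_iff ℚ]
  intro f
  have hp : (∑ l ∈ range n, monomial l (f (m l)) : ℚ[X]) = 0 := by
    refine eq_zero_of_infinite_isRoot _ (hs.mono fun c hc => ?_)
    have := congrArg f (h c hc)
    simpa [eval_finsetSum, mul_comm] using this
  have := congrArg (coeff · l) hp
  simpa [finsetSum_coeff, coeff_monomial, hl] using this

/-- Dedekind's independence of characters; the value at `2` separates the exponents. -/
lemma linearIndependent_zpow :
    LinearIndependent ℚ (fun (i : ℤ) (c : ℚˣ) => (c : ℚ) ^ i) := by
  let χ : ℤ → (ℚˣ →* ℚ) := fun i => (Units.coeHom ℚ).comp (zpowGroupHom i)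
  have hχ : Function.Injective χ := fun i j hij => by
    have := DFunLike.congr_fun hij (Units.mk0 2 two_ne_zero)
    simp only [χ, MonoidHom.comp_apply, zpowGroupHom_apply, Units.coeHom_apply,
      Units.val_zpow_eq_zpow_val, Units.val_mk0] at this
    exact zpow_right_injective₀ (by norm_num) (by norm_num) this
  have := (linearIndependent_monoidHom ℚˣ ℚ).comp χ hχ
  have heq : (fun (i : ℤ) (c : ℚˣ) => (c : ℚ) ^ i) =
      (fun f : ℚˣ →* ℚ => (f : ℚˣ → ℚ)) ∘ χ := by
    ext i c
    simp [χ]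
  rw [heq]
  exact this

/-- A Laurent polynomial with vector coefficients vanishing at all units has zero coefficients. -/
lemma laurent_coeff_eq_zero (s : Finset ℤ) (m : ℤ → M)
    (h : ∀ c : ℚˣ, ∑ i ∈ s, (c : ℚ) ^ i • m i = 0) {i : ℤ} (hi : i ∈ s) : m i = 0 := by
  rw [← Module.forall_dual_apply_eq_zero_iff ℚ]
  intro f
  refine linearIndependent_iff'.1 linearIndependent_zpow s (fun i => f (m i)) ?_ i hi
  ext c
  have := congrArg f (h c)
  simpa [mul_comm] using this

end Independence

/-! ### Root elements, torus and Weyl element, with their relations. -/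

noncomputable section Elements

/-- The upper unitriangular matrix with parameter `a`. -/
def upper (a : ℚ) : SL(2, ℚ) := ⟨!![1, a; 0, 1], by simp [Matrix.det_fin_two_of]⟩

/-- The lower unitriangular matrix with parameter `b`. -/
def lower (b : ℚ) : SL(2, ℚ) := ⟨!![1, 0; b, 1], by simp [Matrix.det_fin_two_of]⟩

/-- The diagonal matrix with entries `c` and `c⁻¹`. -/
def torus (c : ℚˣ) : SL(2, ℚ) :=
  ⟨!![(c : ℚ), 0; 0, (c : ℚ)⁻¹], by simp [Matrix.det_fin_two_of]⟩

/-- The Weyl element. -/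
def weyl : SL(2, ℚ) := ⟨!![0, 1; -1, 0], by simp [Matrix.det_fin_two_of]⟩

lemma coe_upper (a : ℚ) : (upper a).1 = !![1, a; 0, 1] := rfl

lemma coe_lower (b : ℚ) : (lower b).1 = !![1, 0; b, 1] := rfl

lemma coe_torus (c : ℚˣ) : (torus c).1 = !![(c : ℚ), 0; 0, (c : ℚ)⁻¹] := rfl

lemma coe_weyl : weyl.1 = !![0, 1; -1, 0] := rfl

lemma eq_of_entries {g h : SL(2, ℚ)} (h00 : g.1 0 0 = h.1 0 0) (h01 : g.1 0 1 = h.1 0 1)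
    (h10 : g.1 1 0 = h.1 1 0) (h11 : g.1 1 1 = h.1 1 1) : g = h := by
  apply Subtype.ext
  ext i j
  fin_cases i <;> fin_cases j <;> assumption

lemma upper_add (a b : ℚ) : upper (a + b) = upper a * upper b := by
  apply eq_of_entries <;> simp [coe_upper, add_comm]

@[simp] lemma upper_zero : upper 0 = 1 := by
  apply eq_of_entries <;> simp [coe_upper]

/-- The upper unitriangular subgroup as a homomorphism. -/
def upperHom : Multiplicative ℚ →* SL(2, ℚ) where
  toFun a := upper a.toAdd
  map_one' := upper_zero
  map_mul' _ _ := upper_add _ _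

lemma weyl_mul_upper (a : ℚ) : weyl * upper a = lower (-a) * weyl := by
  apply eq_of_entries <;> simp [coe_upper, coe_lower, coe_weyl]

lemma torus_mul_upper (c : ℚˣ) (a : ℚ) :
    torus c * upper a = upper ((c : ℚ) ^ 2 * a) * torus c := by
  have := c.ne_zero
  apply eq_of_entries <;> simp [coe_upper, coe_torus]
  field_simp

lemma torus_mul_lower (c : ℚˣ) (a : ℚ) :
    torus c * lower a = lower (((c : ℚ) ^ 2)⁻¹ * a) * torus c := by
  have := c.ne_zero
  apply eq_of_entries <;> simp [coe_lower, coe_torus]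
  field_simp

lemma torus_mul (c d : ℚˣ) : torus (c * d) = torus c * torus d := by
  apply eq_of_entries <;> simp [coe_torus, mul_comm]

@[simp] lemma torus_one : torus 1 = 1 := by
  apply eq_of_entries <;> simp [coe_torus]

lemma torus_mul_weyl (c : ℚˣ) : torus c * weyl = weyl * torus c⁻¹ := by
  apply eq_of_entries <;> simp [coe_torus, coe_weyl]

lemma torus_mul_weyl_eq (c : ℚˣ) :
    torus c * weyl = upper c * lower (-(c : ℚ)⁻¹) * upper c := by
  apply eq_of_entries <;> simp [coe_torus, coe_weyl, coe_upper, coe_lower]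

lemma lower_eq (b : ℚˣ) : lower b =
    upper (b : ℚ)⁻¹ * (torus (-b⁻¹) * (weyl * upper (b : ℚ)⁻¹)) := by
  apply eq_of_entries <;> simp [coe_torus, coe_weyl, coe_upper, coe_lower]

/-- A nontrivial unipotent element of `SL₂(ℚ)` is conjugate to an upper unitriangular matrix. -/
lemma IsUnipotent.exists_conj {u : SL(2, ℚ)} (hu : IsUnipotent u) (h1 : u ≠ 1) :
    ∃ (g : SL(2, ℚ)) (a : ℚ), a ≠ 0 ∧ u * g = g * upper a := by
  have htr := (Matrix.isNilpotent_trace_of_isNilpotent hu).eq_zero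
  have hdet : (u.1 - 1).det = 0 := by
    obtain ⟨n, hn⟩ := hu
    have := congrArg Matrix.det hn
    rw [Matrix.det_pow] at this
    refine eq_zero_of_pow_eq_zero (n := n + 1) ?_
    rw [pow_succ', this]
    simp
  obtain ⟨p, hp⟩ : ∃ p, u.1 0 0 = 1 + p := ⟨u.1 0 0 - 1, by ring⟩
  obtain ⟨q, hq⟩ : ∃ q, u.1 0 1 = q := ⟨_, rfl⟩
  obtain ⟨r, hr⟩ : ∃ r, u.1 1 0 = r := ⟨_, rfl⟩
  have hs : u.1 1 1 = 1 - p := by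
    simp [Matrix.trace_fin_two, hp] at htr
    linarith
  have hpq : p ^ 2 + q * r = 0 := by
    simp [Matrix.det_fin_two, hp, hq, hr, hs] at hdet
    linarith
  by_cases h : r = 0
  · have hp0 : p = 0 := by simpa [h] using hpq
    have hu' : u = upper q := by
      apply eq_of_entries <;> simp [coe_upper, hp, hq, hr, hs, h, hp0]
    refine ⟨1, q, ?_, by simp [hu']⟩
    rintro rfl
    exact h1 (by simp [hu'])
  -- The first column `(p, r)` is fixed by `u`, because `p ^ 2 + q * r = 0`; the second column makes
  -- the determinant `1`.
  · obtain ⟨g, hg⟩ : ∃ g : SL(2, ℚ), g.1 = !![p, -r⁻¹; r, 0] :=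
      ⟨⟨_, by simp [Matrix.det_fin_two_of, h]⟩, rfl⟩
    refine ⟨g, -r⁻¹, by simpa using h, ?_⟩
    apply eq_of_entries
    · simp [coe_upper, Matrix.mul_apply, Fin.sum_univ_two, hg, hp, hq]
      linear_combination hpq
    · simp [coe_upper, Matrix.mul_apply, Fin.sum_univ_two, hg, hp]
      field_simp
      ring
    · simp [coe_upper, Matrix.mul_apply, Fin.sum_univ_two, hg, hr, hs]
      ring
    · simp [coe_upper, Matrix.mul_apply, Fin.sum_univ_two, hg, hr, h]

end Elements

/-! ### From one unipotent element to logarithms of both root subgroups. -/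

section Generators

variable {A : Type*} [Ring A]

lemma unipotent_pow {z : A} (h : (z - 1) ^ 5 = 0) (n : ℕ) : (z ^ n - 1) ^ 5 = 0 := by
  rw [← mul_geom_sum, Commute.mul_pow, h, zero_mul]
  refine Commute.sum_right _ _ _ fun i _ => ?_
  exact ((Commute.refl z).sub_left (Commute.one_left z)).pow_right i

lemma unipotent_inv {z y : A} (h : (z - 1) ^ 5 = 0) (hzy : z * y = 1) (hyz : y * z = 1) :
    (y - 1) ^ 5 = 0 := by
  have h1 : y - 1 = (z - 1) * (-y) := by simp [sub_mul, hzy]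
  have h2 : Commute (z - 1) (-y) := by
    rw [Commute, SemiconjBy, sub_mul, mul_sub]; simp [hzy, hyz]
  rw [h1, h2.mul_pow, h, zero_mul]

variable {G : Type*} [Group G] (ρ : G →* A)

lemma unipotent_conj {g u k : G} (hk : u * g = g * k) (h : (ρ k - 1) ^ 5 = 0) :
    (ρ u - 1) ^ 5 = 0 := by
  have hu : u = g * k * g⁻¹ := eq_mul_inv_of_mul_eq hk
  have hg : ρ g * ρ g⁻¹ = 1 := by rw [← map_mul, mul_inv_cancel, map_one]
  have hg' : ρ g⁻¹ * ρ g = 1 := by rw [← map_mul, inv_mul_cancel, map_one]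
  have h1 : ρ u - 1 = ρ g * (ρ k - 1) * ρ g⁻¹ := by
    rw [hu, map_mul, map_mul, mul_sub, sub_mul, mul_one, hg]
  have h2 : SemiconjBy (ρ g) (ρ k - 1) (ρ u - 1) := by
    rw [SemiconjBy, h1, mul_assoc _ (ρ g⁻¹), hg', mul_one]
  have h3 := (h2.pow_right 5).eq
  rw [h, mul_zero] at h3
  calc (ρ u - 1) ^ 5 = (ρ u - 1) ^ 5 * (ρ g * ρ g⁻¹) := by rw [hg, mul_one]
    _ = 0 := by rw [← mul_assoc, ← h3, zero_mul]

lemma unipotent_upper (ρ : SL(2, ℚ) →* A) {a : ℚ} (ha : a ≠ 0)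
    (h : (ρ (upper a) - 1) ^ 5 = 0) (b : ℚ) : (ρ (upper b) - 1) ^ 5 = 0 := by
  have hnat : ∀ n : ℕ, (ρ (upper (n * a)) - 1) ^ 5 = 0 := fun n => by
    have : upper (n * a) = upper a ^ n := by
      have := map_pow upperHom (.ofAdd a) n
      rw [← ofAdd_nsmul] at this
      simpa [upperHom] using this
    rw [this, map_pow]
    exact unipotent_pow h n
  have hneg : ∀ b, (ρ (upper b) - 1) ^ 5 = 0 → (ρ (upper (-b)) - 1) ^ 5 = 0 := fun b hb => by
    refine unipotent_inv hb ?_ ?_ <;> simp [← map_mul, ← upper_add]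
  have hint : ∀ n : ℤ, (ρ (upper (n * a)) - 1) ^ 5 = 0 := fun n => by
    obtain ⟨m, rfl | rfl⟩ := n.eq_nat_or_neg
    · exact_mod_cast hnat m
    · have := hneg _ (hnat m)
      push_cast
      rwa [neg_mul]
  set q := b / a with hq
  have hd : (q.den : ℚ) ≠ 0 := by exact_mod_cast q.den_ne_zero
  refine unipotent_conj ρ (g := (torus (Units.mk0 _ hd))⁻¹) ?_ (hint (q.num * q.den))
  have := torus_mul_upper (Units.mk0 _ hd) b
  -- The torus scales the parameter by a square, so conjugating by the denominator of `b / a` turns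
  -- `b` into an integer multiple of `a`.
  have hb : ((Units.mk0 _ hd : ℚˣ) : ℚ) ^ 2 * b = ((q.num * q.den : ℤ) : ℚ) * a := by
    have h1 : b = q.num / q.den * a := by
      rw [Rat.num_div_den, hq, div_mul_cancel₀ _ ha]
    nth_rewrite 1 [h1]
    rw [Units.val_mk0]
    push_cast
    field_simp
  rw [hb] at this
  rw [eq_inv_mul_iff_mul_eq, ← mul_assoc, this, mul_inv_cancel_right]

variable [Algebra ℚ A]

/-- The elements `x`, `y` are nilpotent logarithms of the two root subgroups of `SL₂(ℚ)`. -/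
structure IsLogPair (ρ : SL(2, ℚ) →* A) (x y : A) : Prop where
  x_pow : x ^ 5 = 0
  y_pow : y ^ 5 = 0
  map_upper : ∀ a, ρ (upper a) = expFive (a • x)
  map_lower : ∀ b, ρ (lower b) = expFive (b • y)
  torus_x : ∀ c : ℚˣ, ρ (torus c) * x = (c : ℚ) ^ 2 • (x * ρ (torus c))
  torus_y : ∀ c : ℚˣ, ρ (torus c) * y = ((c : ℚ) ^ 2)⁻¹ • (y * ρ (torus c))

lemma expFive_coeff_one {x y : A}
    (h : ∀ a : ℚ, expFive (a • x) = expFive (a • y)) : x = y := by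
  have := coeff_eq_zero_of_infinite (M := A) Set.infinite_univ 5
    (fun l => (1 / (l.factorial : ℚ)) • (x ^ l - y ^ l)) (fun a _ => by
      have := h a
      rw [← sub_eq_zero, expFive, expFive, ← sum_sub_distrib] at this
      rw [← this]
      refine sum_congr rfl fun l _ => ?_
      rw [smul_pow, smul_pow, smul_sub, smul_sub]
      simp only [smul_smul]
      rw [mul_comm]) (l := 1) (by norm_num)
  simpa [sub_eq_zero] using this

lemma expFive_semiconj {g x y : A} (h : SemiconjBy g x y) :
    SemiconjBy g (expFive x) (expFive y) := by
  rw [expFive, expFive, SemiconjBy, mul_sum, sum_mul]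
  refine sum_congr rfl fun l _ => ?_
  rw [mul_smul_comm, smul_mul_assoc, (h.pow_right l).eq]

lemma exists_isLogPair (ρ : SL(2, ℚ) →* A) (h : ∀ a, (ρ (upper a) - 1) ^ 5 = 0) :
    ∃ x y, IsLogPair ρ x y := by
  obtain ⟨x, hx5, hx⟩ : ∃ x : A, x ^ 5 = 0 ∧ ∀ a, ρ (upper a) = expFive (a • x) :=
    ⟨_, logFive_pow (h 1), exists_expFive (ρ.comp upperHom) fun a => h a.toAdd⟩
  have hw : ρ weyl⁻¹ * ρ weyl = 1 := by rw [← map_mul, inv_mul_cancel, map_one]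
  have hw' : ρ weyl * ρ weyl⁻¹ = 1 := by rw [← map_mul, mul_inv_cancel, map_one]
  -- The sign comes from `weyl_mul_upper`: the Weyl element carries `upper a` to `lower (-a)`.
  set y := -(ρ weyl * x * ρ weyl⁻¹) with hy_def
  have hwx : SemiconjBy (ρ weyl) x (-y) := by
    rw [SemiconjBy, hy_def, neg_neg, mul_assoc _ (ρ weyl⁻¹), hw, mul_one]
  have hy : ∀ b, ρ (lower b) = expFive (b • y) := fun b => by
    have h1 := congrArg ρ (weyl_mul_upper (-b))
    rw [map_mul, map_mul, neg_neg, hx] at h1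
    have h2 : SemiconjBy (ρ weyl) (-b • x) (b • y) := by
      have := hwx
      rw [SemiconjBy] at this ⊢
      rw [mul_smul_comm, this, smul_mul_assoc]
      simp
    have h3 := (expFive_semiconj h2).eq
    rw [h1] at h3
    calc ρ (lower b) = ρ (lower b) * ρ weyl * ρ weyl⁻¹ := by rw [mul_assoc, hw', mul_one]
      _ = _ := by rw [h3, mul_assoc, hw', mul_one]
  have hy5 : y ^ 5 = 0 := by
    have := (hwx.pow_right 5).eq
    rw [hx5, mul_zero, neg_pow] at this
    have h2 : ((-1) ^ 5 * y ^ 5 * ρ weyl) * ρ weyl⁻¹ = 0 := by rw [← this, zero_mul]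
    rw [mul_assoc, hw', mul_one] at h2
    simpa using h2
  have aux : ∀ (c : ℚˣ) (r : ℚ) (z : A) (f : ℚ → SL(2, ℚ)), (∀ a, ρ (f a) = expFive (a • z)) →
      (∀ a, torus c * f a = f (r * a) * torus c) →
      ρ (torus c) * z = r • (z * ρ (torus c)) := by
    intro c r z f hf hc
    have ht : ρ (torus c)⁻¹ * ρ (torus c) = 1 := by rw [← map_mul, inv_mul_cancel, map_one]
    have ht' : ρ (torus c) * ρ (torus c)⁻¹ = 1 := by rw [← map_mul, mul_inv_cancel, map_one]
    -- Both sides generate the same one-parameter group, so their linear coefficients agree.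
    have key : ρ (torus c) * z * ρ (torus c)⁻¹ = r • z := by
      apply expFive_coeff_one
      intro a
      have h1 : SemiconjBy (ρ (torus c)) (a • z) (a • (ρ (torus c) * z * ρ (torus c)⁻¹)) := by
        rw [SemiconjBy, mul_smul_comm, smul_mul_assoc, mul_assoc _ (ρ (torus c)⁻¹), ht, mul_one]
      have h2 := (expFive_semiconj h1).eq
      have h3 := congrArg ρ (hc a)
      rw [map_mul, map_mul, hf, hf, h2] at h3
      have h4 := congrArg (· * ρ (torus c)⁻¹) h3
      simp only [mul_assoc, ht', mul_one] at h4
      simp only [mul_assoc]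
      rw [h4, smul_smul, mul_comm]
    have := congrArg (· * ρ (torus c)) key
    simpa only [mul_assoc, ht, mul_one, smul_mul_assoc] using this
  exact ⟨x, y, hx5, hy5, hx, hy, fun c => aux c _ x _ hx (torus_mul_upper c),
    fun c => aux c _ y _ hy (torus_mul_lower c)⟩

end Generators

/-! ### Comparison of Laurent coefficients. -/

section Laurent

variable {M : Type*} [AddCommGroup M] [Module ℚ M]

/-- Comparison of coefficients for two Laurent polynomials with vector coefficients. -/
lemma laurent_compare {ι κ : Type*} {s : Finset ι} {t : Finset κ} {e : ι → ℤ} {f : κ → ℤ}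
    {m : ι → M} {n : κ → M}
    (h : ∀ c : ℚˣ, ∑ j ∈ s, (c : ℚ) ^ e j • m j = ∑ j ∈ t, (c : ℚ) ^ f j • n j) (i : ℤ) :
    ∑ j ∈ s with e j = i, m j = ∑ j ∈ t with f j = i, n j := by
  -- Inserting `i` covers the case where it is an exponent on neither side.
  set r := insert i (s.image e ∪ t.image f)
  have h1 : ∀ c : ℚˣ, ∑ i ∈ r, (c : ℚ) ^ i • ∑ j ∈ s with e j = i, m j =
      ∑ j ∈ s, (c : ℚ) ^ e j • m j := fun c => by
    rw [← sum_fiberwise_of_maps_to (s := s) (t := r) (g := e) fun j hj =>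
      mem_insert_of_mem (mem_union_left _ (mem_image_of_mem e hj))]
    refine sum_congr rfl fun i _ => ?_
    rw [smul_sum]
    exact sum_congr rfl fun j hj => by rw [(mem_filter.1 hj).2]
  have h2 : ∀ c : ℚˣ, ∑ i ∈ r, (c : ℚ) ^ i • ∑ j ∈ t with f j = i, n j =
      ∑ j ∈ t, (c : ℚ) ^ f j • n j := fun c => by
    rw [← sum_fiberwise_of_maps_to (s := t) (t := r) (g := f) fun j hj =>
      mem_insert_of_mem (mem_union_right _ (mem_image_of_mem f hj))]
    refine sum_congr rfl fun i _ => ?_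
    rw [smul_sum]
    exact sum_congr rfl fun j hj => by rw [(mem_filter.1 hj).2]
  have := laurent_coeff_eq_zero r
    (fun i => ∑ j ∈ s with e j = i, m j - ∑ j ∈ t with f j = i, n j) (fun c => by
      simp only [smul_sub, sum_sub_distrib]
      rw [h1, h2, h, sub_self]) (mem_insert_self i _)
  exact sub_eq_zero.1 this

end Laurent

/-! ### Weight decomposition and highest weight vectors. -/

section Weights

variable {M : Type*} [AddCommGroup M] [Module ℚ M]

/-- The weight spaces of the diagonal torus of `SL₂(ℚ)`. -/
def weightSpace (ρ : SL(2, ℚ) →* Module.End ℚ M) (i : ℤ) : Submodule ℚ M where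
  carrier := {m | ∀ c : ℚˣ, ρ (torus c) m = (c : ℚ) ^ i • m}
  add_mem' ha hb c := by rw [map_add, ha c, hb c, smul_add]
  zero_mem' c := by simp
  smul_mem' r m hm c := by rw [map_smul, hm c, smul_comm]

variable {ρ : SL(2, ℚ) →* Module.End ℚ M} {x y : Module.End ℚ M}

lemma weyl_mem_weightSpace {i : ℤ} {m : M} (hm : m ∈ weightSpace ρ i) :
    ρ weyl m ∈ weightSpace ρ (-i) := fun c => by
  rw [← Module.End.mul_apply, ← map_mul, torus_mul_weyl, map_mul, Module.End.mul_apply, hm c⁻¹]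
  simp

namespace IsLogPair

variable (h : IsLogPair ρ x y)
include h

lemma upper_apply (a : ℚ) (m : M) :
    ρ (upper a) m = ∑ l ∈ range 5, a ^ l • (1 / (l.factorial : ℚ)) • (x ^ l) m := by
  rw [h.map_upper, expFive, LinearMap.sum_apply]
  refine sum_congr rfl fun l _ => ?_
  rw [smul_pow, smul_comm]
  rfl

lemma lower_apply (a : ℚ) (m : M) :
    ρ (lower a) m = ∑ l ∈ range 5, a ^ l • (1 / (l.factorial : ℚ)) • (y ^ l) m := by
  rw [h.map_lower, expFive, LinearMap.sum_apply]
  refine sum_congr rfl fun l _ => ?_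
  rw [smul_pow, smul_comm]
  rfl

lemma upper_apply_of_ker {m : M} (hm : x m = 0) (a : ℚ) : ρ (upper a) m = m := by
  rw [h.upper_apply, sum_eq_single 0]
  · simp
  · intro l _ hl
    obtain ⟨n, rfl⟩ := Nat.exists_eq_succ_of_ne_zero hl
    have : (x ^ (n + 1)) m = 0 := by rw [pow_succ, Module.End.mul_apply, hm, map_zero]
    simp [this]
  · simp

lemma x_mem {i : ℤ} {m : M} (hm : m ∈ weightSpace ρ i) : x m ∈ weightSpace ρ (i + 2) := fun c => by
  rw [← Module.End.mul_apply, h.torus_x, LinearMap.smul_apply, Module.End.mul_apply, hm c,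
    map_smul, smul_smul, zpow_add₀ c.ne_zero, mul_comm]
  rfl

lemma y_mem {i : ℤ} {m : M} (hm : m ∈ weightSpace ρ i) : y m ∈ weightSpace ρ (i - 2) := fun c => by
  rw [← Module.End.mul_apply, h.torus_y, LinearMap.smul_apply, Module.End.mul_apply, hm c,
    map_smul, smul_smul, zpow_sub₀ c.ne_zero, mul_comm, div_eq_mul_inv]
  rfl

lemma x_pow_mem {i : ℤ} {m : M} (hm : m ∈ weightSpace ρ i) (l : ℕ) :
    (x ^ l) m ∈ weightSpace ρ (i + 2 * l) := by
  induction l with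
  | zero => simpa using hm
  | succ l ih =>
    rw [pow_succ', Module.End.mul_apply]
    convert h.x_mem ih using 2
    push_cast
    ring

lemma y_pow_mem {i : ℤ} {m : M} (hm : m ∈ weightSpace ρ i) (l : ℕ) :
    (y ^ l) m ∈ weightSpace ρ (i - 2 * l) := by
  induction l with
  | zero => simpa using hm
  | succ l ih =>
    rw [pow_succ', Module.End.mul_apply]
    convert h.y_mem ih using 2
    push_cast
    ring

/-- The torus acts by Laurent polynomials. -/
lemma exists_torus_laurent : ∃ (s : Finset (ℕ × ℕ × ℕ)) (e : ℕ × ℕ × ℕ → ℤ)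
    (T : ℕ × ℕ × ℕ → Module.End ℚ M), ∀ c : ℚˣ, ρ (torus c) = ∑ j ∈ s, (c : ℚ) ^ e j • T j := by
  refine ⟨range 5 ×ˢ range 5 ×ˢ range 5, fun j => j.1 - j.2.1 + j.2.2, fun j =>
    ((1 / (j.1.factorial : ℚ)) • x ^ j.1) * (((-1) ^ j.2.1 * (1 / (j.2.1.factorial : ℚ))) • y ^ j.2.1)
      * ((1 / (j.2.2.factorial : ℚ)) • x ^ j.2.2) * ρ weyl⁻¹, fun c => ?_⟩
  have hc := c.ne_zero
  -- Each root factor is polynomial in `c` or `c⁻¹`, of degree at most four.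
  have h1 : ρ (torus c) = ρ (upper c) * (ρ (lower (-(c : ℚ)⁻¹)) *
      (ρ (upper c) * ρ weyl⁻¹)) := by
    simp only [← map_mul]
    rw [← mul_assoc, ← mul_assoc, ← torus_mul_weyl_eq, mul_inv_cancel_right]
  rw [h1, h.map_upper, h.map_lower, expFive, expFive, sum_mul, sum_product]
  refine sum_congr rfl fun a _ => ?_
  rw [sum_mul, mul_sum, sum_product]
  refine sum_congr rfl fun b _ => ?_
  rw [sum_mul, mul_sum, mul_sum]
  refine sum_congr rfl fun d _ => ?_
  simp only [smul_pow, smul_mul_assoc, mul_smul_comm, smul_smul, mul_assoc]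
  congr 1
  rw [zpow_add₀ hc, zpow_sub₀ hc, neg_pow, inv_pow]
  simp only [zpow_natCast]
  ring

/-- The module is the sum of its weight spaces. -/
lemma iSup_weightSpace : ⨆ i, weightSpace ρ i = ⊤ := by
  obtain ⟨s, e, T, hT⟩ := h.exists_torus_laurent
  rw [eq_top_iff]
  rintro m -
  set P : ℤ → M := fun i => ∑ j ∈ s with e j = i, T j m with hP
  have hPm : ∀ c : ℚˣ, ρ (torus c) m = ∑ i ∈ s.image e, (c : ℚ) ^ i • P i := fun c => by
    rw [hT, LinearMap.sum_apply, ← sum_fiberwise_of_maps_to (s := s) (t := s.image e) (g := e)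
      fun j hj => mem_image_of_mem e hj]
    refine sum_congr rfl fun i _ => ?_
    rw [hP, smul_sum]
    exact sum_congr rfl fun j hj => by rw [(mem_filter.1 hj).2]; rfl
  -- Expand the action of `torus (c * d) = torus c * torus d` on `m` and compare coefficients in
  -- `d`. Setting `c = 1` in `hPm` later gives `m` as the sum of the `P i`.
  have hmem : ∀ i ∈ s.image e, P i ∈ weightSpace ρ i := fun i hi c => by
    rw [← sub_eq_zero]
    refine laurent_coeff_eq_zero (s.image e) (fun i => ρ (torus c) (P i) - (c : ℚ) ^ i • P i)
      (fun d => ?_) hi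
    have h1 : ρ (torus c) (ρ (torus d) m) = ρ (torus (c * d)) m := by
      rw [torus_mul, map_mul, Module.End.mul_apply]
    rw [hPm, hPm, map_sum, ← sub_eq_zero, ← sum_sub_distrib] at h1
    rw [← h1]
    refine sum_congr rfl fun i _ => ?_
    rw [map_smul, smul_sub, smul_smul, Units.val_mul, mul_zpow, mul_comm]
  have hm := hPm 1
  rw [torus_one, map_one, Module.End.one_apply] at hm
  rw [hm]
  refine Submodule.sum_mem _ fun i hi => Submodule.smul_mem _ _ ?_
  exact Submodule.mem_iSup_of_mem i (hmem i hi)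

variable {k : ℤ} {p : M}

/-- In `lower_eq` the rightmost factor fixes `p`, the torus factor acts on `ρ weyl p` by `(-c) ^ k`,
and the left factor expands in powers of `c⁻¹`. The identity compares coefficients of `c ^ i`. -/
lemma lower_highest (hp : p ∈ weightSpace ρ k) (hx : x p = 0) (i : ℤ) :
    ∑ l ∈ (range 5).filter (fun l : ℕ => (l : ℤ) = i), (1 / (l.factorial : ℚ)) • (y ^ l) p =
    ∑ n ∈ (range 5).filter (fun n : ℕ => k - (n : ℤ) = i),
      ((-1) ^ k * (1 / (n.factorial : ℚ))) • (x ^ n) (ρ weyl p) := by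
  refine laurent_compare (fun c => ?_) i
  have hc := c.ne_zero
  have h1 := h.lower_apply c p
  simp only [zpow_natCast]
  rw [← h1, lower_eq, map_mul, map_mul, map_mul, Module.End.mul_apply, Module.End.mul_apply,
    Module.End.mul_apply, h.upper_apply_of_ker hx, weyl_mem_weightSpace hp, map_smul, h.upper_apply,
    smul_sum]
  refine sum_congr rfl fun n _ => ?_
  rw [smul_smul, smul_smul, smul_smul]
  congr 1
  rw [zpow_sub₀ hc, Units.val_neg, Units.val_inv_eq_inv_val, ← inv_neg, inv_zpow', neg_neg,
    neg_eq_neg_one_mul, mul_zpow, zpow_natCast, inv_pow]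
  ring

/-- The exponents `K - n` on the right of `lower_highest` never exceed `K`. -/
lemma y_pow_eq_zero {K l : ℕ} (hp : p ∈ weightSpace ρ K) (hx : x p = 0) (hl : K < l) :
    (y ^ l) p = 0 := by
  have := h.lower_highest hp hx l
  rw [sum_filter, sum_filter, sum_eq_single l, sum_eq_zero] at this
  · simpa [Nat.factorial_ne_zero] using this
  · intro n _
    rw [if_neg (by omega)]
  · intro n _ hn
    rw [if_neg (by omega)]
  · intro hl
    rw [mem_range, not_lt] at hl
    rw [pow_eq_zero_of_le hl h.y_pow]
    simp

lemma y_pow_eq {K l : ℕ} (hp : p ∈ weightSpace ρ K) (hx : x p = 0) (hl : l ≤ K) :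
    (y ^ l) p = ((l.factorial : ℚ) * ((-1) ^ K * (1 / ((K - l).factorial : ℚ)))) •
      (x ^ (K - l)) (ρ weyl p) := by
  have := h.lower_highest hp hx l
  rw [sum_filter, sum_filter, sum_eq_single l, sum_eq_single (K - l)] at this
  · rw [if_pos rfl, if_pos (by omega)] at this
    have h2 : (l.factorial : ℚ) ≠ 0 := by exact_mod_cast l.factorial_ne_zero
    rw [mul_smul, ← zpow_natCast, ← this, smul_smul, mul_one_div_cancel h2, one_smul]
  · intro n _ hn
    rw [if_neg (by omega)]
  · intro hl
    rw [mem_range, not_lt] at hl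
    rw [pow_eq_zero_of_le hl h.x_pow]
    simp
  · intro n _ hn
    rw [if_neg (by omega)]
  · intro hl
    rw [mem_range, not_lt] at hl
    rw [pow_eq_zero_of_le hl h.y_pow]
    simp

/-- The case `l = 0` of `y_pow_eq` makes `p` a multiple of `x ^ K` applied to a vector. -/
lemma eq_zero_of_five_le {K : ℕ} (hp : p ∈ weightSpace ρ K) (hx : x p = 0) (hK : 5 ≤ K) :
    p = 0 := by
  have := h.y_pow_eq hp hx (Nat.zero_le K)
  rw [Nat.sub_zero, pow_eq_zero_of_le hK h.x_pow] at this
  simpa using this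

/-- By `y_pow_eq`, `x ^ j y ^ j p` and `p` are both nonzero multiples of `x ^ K (ρ weyl p)`. -/
lemma exists_x_pow_y_pow {K j : ℕ} (hp : p ∈ weightSpace ρ K) (hx : x p = 0) (hj : j ≤ K) :
    ∃ r : ℚ, r ≠ 0 ∧ (x ^ j) ((y ^ j) p) = r • p := by
  have h0 := h.y_pow_eq hp hx (Nat.zero_le K)
  have h1 := h.y_pow_eq hp hx hj
  set a : ℚ := ((0).factorial : ℚ) * ((-1) ^ K * (1 / ((K - 0).factorial : ℚ)))
  set b : ℚ := (j.factorial : ℚ) * ((-1) ^ K * (1 / ((K - j).factorial : ℚ)))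
  have ha : a ≠ 0 := by simp [a, Nat.factorial_ne_zero]
  have hb : b ≠ 0 := by simp [b, Nat.factorial_ne_zero]
  refine ⟨b * a⁻¹, mul_ne_zero hb (inv_ne_zero ha), ?_⟩
  rw [h1, map_smul, ← Module.End.mul_apply, ← pow_add, Nat.add_sub_cancel' hj, mul_smul b a⁻¹]
  refine congrArg (fun v : M => b • v) ?_
  rw [pow_zero, Module.End.one_apply, Nat.sub_zero] at h0
  rw [eq_inv_smul_iff₀ ha, ← h0]

/-- A subspace stable under `y` and the Weyl element, and containing all highest weight vectors of
nonnegative weight, is the whole space. -/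
lemma eq_top_of_highest (S : Submodule ℚ M) (hy : ∀ m ∈ S, y m ∈ S) (hw : ∀ m ∈ S, ρ weyl m ∈ S)
    (hS : ∀ (K : ℕ) (p : M), p ∈ weightSpace ρ K → x p = 0 → p ∈ S) : S = ⊤ := by
  have hyl : ∀ (l : ℕ) (m : M), m ∈ S → (y ^ l) m ∈ S := fun l => by
    induction l with
    | zero => simp
    | succ l ih =>
      intro m hm
      rw [pow_succ, Module.End.mul_apply]
      exact ih _ (hy _ hm)
  -- Induction on the order of nilpotency: `x ^ l m` is a highest weight vector of weight `i + 2 * l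
  -- ≥ l`, and subtracting a multiple of `y ^ l x ^ l m` from `m` lowers the order.
  have pos : ∀ (l : ℕ) (i : ℕ) (m : M), m ∈ weightSpace ρ i → (x ^ l) m = 0 → m ∈ S := fun l => by
    induction l with
    | zero =>
      intro i m _ h0
      rw [pow_zero, Module.End.one_apply] at h0
      rw [h0]
      exact S.zero_mem
    | succ l ih =>
      intro i m hm h0
      have hp : (x ^ l) m ∈ weightSpace ρ ((i + 2 * l : ℕ) : ℤ) := by
        exact_mod_cast h.x_pow_mem hm l
      have hx : x ((x ^ l) m) = 0 := by rwa [← Module.End.mul_apply, ← pow_succ']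
      obtain ⟨r, hr, hr'⟩ := h.exists_x_pow_y_pow hp hx (j := l) (by omega)
      have h1 : r⁻¹ • (y ^ l) ((x ^ l) m) ∈ S := S.smul_mem _ (hyl l _ (hS _ _ hp hx))
      have h2 : m - r⁻¹ • (y ^ l) ((x ^ l) m) ∈ S := by
        refine ih i _ (Submodule.sub_mem _ hm (Submodule.smul_mem _ _ ?_)) ?_
        · have := h.y_pow_mem hp l
          convert this using 2
          push_cast
          ring
        · rw [map_sub, map_smul, hr', inv_smul_smul₀ hr, sub_self]
      simpa using S.add_mem h2 h1
  rw [eq_top_iff, ← h.iSup_weightSpace]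
  refine iSup_le fun i m hm => ?_
  obtain ⟨n, rfl | rfl⟩ := i.eq_nat_or_neg
  · exact pos 5 n m hm (by rw [h.x_pow]; rfl)
  -- Three Weyl translations make the weight nonnegative; a fourth returns to `m`, as `weyl` has
  -- fourth power `1`.
  · have h1 := weyl_mem_weightSpace (weyl_mem_weightSpace (weyl_mem_weightSpace hm))
    simp only [neg_neg] at h1
    have h2 := hw _ (pos 5 n _ h1 (by rw [h.x_pow]; rfl))
    have h3 : weyl * weyl * weyl * weyl = 1 := by
      apply eq_of_entries <;> simp [coe_weyl]
    rwa [← Module.End.mul_apply, ← Module.End.mul_apply, ← Module.End.mul_apply, ← map_mul,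
      ← map_mul, ← map_mul, h3, map_one] at h2

end IsLogPair

end Weights

/-! ### Monomials and invariant subspaces of the symmetric powers. -/

noncomputable section SymmetricPowers

/-- The monomial `X ^ i * Y ^ j`. -/
def mon (i j : ℕ) : MvPolynomial (Fin 2) ℚ := MvPolynomial.X 0 ^ i * MvPolynomial.X 1 ^ j

lemma mon_eq_monomial (i j : ℕ) :
    mon i j = MvPolynomial.monomial (Finsupp.single 0 i + Finsupp.single 1 j) 1 := by
  rw [mon, MvPolynomial.X_pow_eq_monomial, MvPolynomial.X_pow_eq_monomial,
    MvPolynomial.monomial_mul, one_mul]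

lemma homogeneousSubmodule_eq_span (k : ℕ) : MvPolynomial.homogeneousSubmodule (Fin 2) ℚ k =
    Submodule.span ℚ ((fun j => mon (k - j) j) '' (range (k + 1) : Set ℕ)) := by
  apply le_antisymm
  · intro p hp
    rw [MvPolynomial.mem_homogeneousSubmodule] at hp
    rw [p.as_sum]
    refine Submodule.sum_mem _ fun d hd => ?_
    have hdeg : d 0 + d 1 = k := by
      have := hp (MvPolynomial.mem_support_iff.1 hd)
      simpa [Finsupp.weight_apply, Finsupp.sum_fintype] using this
    have hd' : d = Finsupp.single 0 (k - d 1) + Finsupp.single 1 (d 1) := by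
      ext i
      fin_cases i
      · simp; omega
      · simp
    have : MvPolynomial.monomial d (p.coeff d) = p.coeff d • mon (k - d 1) (d 1) := by
      rw [mon_eq_monomial, ← hd', MvPolynomial.smul_monomial, smul_eq_mul, mul_one]
    rw [this]
    refine Submodule.smul_mem _ _ (Submodule.subset_span ⟨d 1, ?_, rfl⟩)
    simp
    omega
  · rw [Submodule.span_le]
    rintro _ ⟨j, hj, rfl⟩
    have hj' : j < k + 1 := by simpa using hj
    have := ((MvPolynomial.isHomogeneous_X ℚ (0 : Fin 2)).pow (k - j)).mul
      ((MvPolynomial.isHomogeneous_X ℚ (1 : Fin 2)).pow j)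
    simp only [one_mul] at this
    rw [Nat.sub_add_cancel (by omega)] at this
    exact this

lemma mon_mem (k : ℕ) {j : ℕ} (hj : j < k + 1) :
    mon (k - j) j ∈ MvPolynomial.homogeneousSubmodule (Fin 2) ℚ k := by
  rw [homogeneousSubmodule_eq_span]
  exact Submodule.subset_span ⟨j, by simpa using hj, rfl⟩

lemma subst_X_zero (g : SL(2, ℚ)) : subst g (MvPolynomial.X 0) =
    g.1 0 0 • MvPolynomial.X 0 + g.1 1 0 • MvPolynomial.X 1 := by
  rw [subst_X, Fin.sum_univ_two]

lemma subst_X_one (g : SL(2, ℚ)) : subst g (MvPolynomial.X 1) =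
    g.1 0 1 • MvPolynomial.X 0 + g.1 1 1 • MvPolynomial.X 1 := by
  rw [subst_X, Fin.sum_univ_two]

lemma subst_X_zero_pow (g : SL(2, ℚ)) (k : ℕ) : subst g (MvPolynomial.X 0 ^ k) =
    ∑ l ∈ range (k + 1), (g.1 1 0 ^ l * g.1 0 0 ^ (k - l) * (k.choose l : ℚ)) • mon (k - l) l := by
  rw [map_pow, subst_X_zero, add_comm, add_pow]
  refine sum_congr rfl fun l _ => ?_
  rw [smul_pow, smul_pow, smul_mul_smul_comm, mul_smul, mon, mul_comm (MvPolynomial.X 1 ^ l)]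
  rw [mul_comm, ← nsmul_eq_mul, ← Nat.cast_smul_eq_nsmul ℚ, smul_smul, smul_smul]
  congr 1
  ring

lemma subst_torus_mon (c : ℚˣ) (i j : ℕ) :
    subst (torus c) (mon i j) = (c : ℚ) ^ ((i : ℤ) - j) • mon i j := by
  rw [mon, map_mul, map_pow, map_pow, subst_X_zero, subst_X_one]
  simp only [coe_torus, Matrix.of_apply, Matrix.cons_val', Matrix.cons_val_zero,
    Matrix.cons_val_one, Matrix.cons_val_fin_one, zero_smul, add_zero, zero_add]
  rw [smul_pow, smul_pow, smul_mul_smul_comm, zpow_sub₀ c.ne_zero, inv_pow, div_eq_mul_inv,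
    zpow_natCast, zpow_natCast]

lemma subst_upper_mon (a : ℚ) (i j : ℕ) :
    subst (upper a) (mon i j) =
      ∑ l ∈ range (j + 1), a ^ l • ((j.choose l : ℚ) • mon (i + l) (j - l)) := by
  rw [mon, map_mul, map_pow, map_pow, subst_X_zero, subst_X_one]
  simp only [coe_upper, Matrix.of_apply, Matrix.cons_val', Matrix.cons_val_zero,
    Matrix.cons_val_one, Matrix.cons_val_fin_one, zero_smul, add_zero, one_smul]
  rw [add_pow, mul_sum]
  refine sum_congr rfl fun l _ => ?_
  rw [smul_pow, mon, Nat.cast_smul_eq_nsmul, nsmul_eq_mul, pow_add, smul_mul_assoc, smul_mul_assoc,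
    mul_smul_comm]
  congr 1
  ring

lemma subst_lower_X_zero_pow (b : ℚ) (k : ℕ) : subst (lower b) (MvPolynomial.X 0 ^ k) =
    ∑ l ∈ range (k + 1), b ^ l • ((k.choose l : ℚ) • mon (k - l) l) := by
  rw [subst_X_zero_pow]
  simp [coe_lower, smul_smul]

/-- If a polynomial map takes infinitely many values in a subspace, its coefficients lie there. -/
lemma coeff_mem_of_infinite {M : Type*} [AddCommGroup M] [Module ℚ M] (N : Submodule ℚ M)
    {s : Set ℚ} (hs : s.Infinite) (n : ℕ) (m : ℕ → M)
    (h : ∀ c ∈ s, ∑ l ∈ range n, c ^ l • m l ∈ N) {l : ℕ} (hl : l < n) : m l ∈ N := by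
  rw [← Submodule.Quotient.mk_eq_zero]
  refine coeff_eq_zero_of_infinite hs n (fun l => (Submodule.Quotient.mk (m l) : M ⧸ N))
    (fun c hc => ?_) hl
  have := (Submodule.Quotient.mk_eq_zero N).2 (h c hc)
  rw [← Submodule.mkQ_apply, map_sum] at this
  simpa using this

/-- A nonzero invariant subspace of `Sym^k Nat` is the whole of `Sym^k Nat`. -/
lemma homogeneousSubmodule_le_of_stable (k : ℕ) (N : Submodule ℚ (MvPolynomial (Fin 2) ℚ))
    (hN : N ≤ MvPolynomial.homogeneousSubmodule (Fin 2) ℚ k) (h0 : N ≠ ⊥)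
    (hst : ∀ g, ∀ p ∈ N, subst g p ∈ N) :
    MvPolynomial.homogeneousSubmodule (Fin 2) ℚ k ≤ N := by
  obtain ⟨q, hq, hq0⟩ := N.ne_bot_iff.1 h0
  have hqk := hN hq
  rw [homogeneousSubmodule_eq_span, Submodule.mem_span_image_finset_iff_exists_fun'] at hqk
  obtain ⟨r, hr⟩ := hqk
  -- The monomials have distinct torus weights, so `N` contains each weight component of `q`.
  have hcomp : ∀ j ∈ range (k + 1), r j • mon (k - j) j ∈ N := fun j hj => by
    have h1 := laurent_compare (M := MvPolynomial (Fin 2) ℚ ⧸ N) (s := range (k + 1))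
      (t := (∅ : Finset ℕ)) (e := fun j => ((k - j : ℕ) : ℤ) - j) (f := fun j => (j : ℤ))
      (m := fun j => Submodule.Quotient.mk (r j • mon (k - j) j)) (n := fun _ => 0)
      (fun c => by
        have := (Submodule.Quotient.mk_eq_zero N).2 (hst (torus c) q hq)
        rw [← hr, map_sum, ← Submodule.mkQ_apply, map_sum] at this
        rw [sum_empty, ← this]
        refine sum_congr rfl fun j _ => ?_
        rw [map_smul, subst_torus_mon, smul_comm, map_smul]
        rfl) (((k - j : ℕ) : ℤ) - j)
    rw [filter_empty, sum_empty, sum_filter, sum_eq_single j] at h1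
    · simpa only [if_true, Submodule.Quotient.mk_eq_zero] using h1
    · intro i hi hij
      rw [mem_range] at hi hj
      rw [if_neg (by omega)]
    · intro h; exact absurd hj h
  obtain ⟨j, hj, hrj⟩ : ∃ j ∈ range (k + 1), r j ≠ 0 := by
    by_contra! hcon
    apply hq0
    rw [← hr]
    exact sum_eq_zero fun j hj => by rw [hcon j hj, zero_smul]
  have hjm : mon (k - j) j ∈ N := by
    have := N.smul_mem (r j)⁻¹ (hcomp j hj)
    rwa [inv_smul_smul₀ hrj] at this
  -- This is the coefficient of `a ^ j` in the action of `upper a`; the action of `lower b` on it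
  -- then yields all monomials.
  have htop : mon k 0 ∈ N := by
    have := coeff_mem_of_infinite N Set.infinite_univ (j + 1)
      (fun l => (j.choose l : ℚ) • mon (k - j + l) (j - l)) (fun a _ => by
        rw [← subst_upper_mon]; exact hst _ _ hjm) (l := j) (by omega)
    rw [mem_range] at hj
    simpa [Nat.sub_add_cancel (show j ≤ k by omega)] using this
  rw [homogeneousSubmodule_eq_span, Submodule.span_le]
  rintro _ ⟨l, hl, rfl⟩
  have hl' : l < k + 1 := by simpa using hl
  have := coeff_mem_of_infinite N Set.infinite_univ (k + 1)
    (fun l => (k.choose l : ℚ) • mon (k - l) l) (fun b _ => by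
      rw [← subst_lower_X_zero_pow]
      apply hst
      simpa [mon] using htop) hl'
  have hc : (k.choose l : ℚ) ≠ 0 := by
    exact_mod_cast (Nat.choose_pos (by omega)).ne'
  have := N.smul_mem (k.choose l : ℚ)⁻¹ this
  rwa [inv_smul_smul₀ hc] at this

end SymmetricPowers

/-! ### Equivariant maps from symmetric powers to the module. -/

noncomputable section Embedding

variable {M : Type*} [AddCommGroup M] [Module ℚ M]

/-- The linear map sending `X ^ i * Y ^ j` to `i! • y ^ j p`. -/
def symMap (y : Module.End ℚ M) (p : M) : MvPolynomial (Fin 2) ℚ →ₗ[ℚ] M :=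
  (MvPolynomial.basisMonomials (Fin 2) ℚ).constr ℚ fun d => ((d 0).factorial : ℚ) • (y ^ d 1) p

lemma symMap_mon (y : Module.End ℚ M) (p : M) (i j : ℕ) :
    symMap y p (mon i j) = (i.factorial : ℚ) • (y ^ j) p := by
  have := (MvPolynomial.basisMonomials (Fin 2) ℚ).constr_basis ℚ
    (fun d => ((d 0).factorial : ℚ) • (y ^ d 1) p) (Finsupp.single 0 i + Finsupp.single 1 j)
  rw [MvPolynomial.coe_basisMonomials] at this
  rw [mon_eq_monomial, symMap, this]
  simp

variable {ρ : SL(2, ℚ) →* Module.End ℚ M} {x y : Module.End ℚ M} {p : M} {k : ℕ}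

lemma eq_lower_mul_torus_mul_upper (g : SL(2, ℚ)) (c : ℚˣ) (hc : g.1 0 0 = c) :
    g = lower (g.1 1 0 / c) * (torus c * upper (g.1 0 1 / c)) := by
  have h0 := c.ne_zero
  have hd : (c : ℚ) * g.1 1 1 - g.1 0 1 * g.1 1 0 = 1 := by
    rw [← hc, ← Matrix.det_fin_two]; exact g.2
  apply eq_of_entries <;> simp [coe_lower, coe_upper, coe_torus, hc] <;> field_simp
  linear_combination hd

/-- On the big cell `g` factors as lower, torus, upper, so `ρ g p` is an explicit sum of `y ^ l p`.
The factorial in `symMap` matches the binomial coefficients, via `k.choose l * (k - l)! = k! / l!`.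
-/
lemma IsLogPair.symMap_orbit (h : IsLogPair ρ x y) (hp : p ∈ weightSpace ρ k) (hx : x p = 0)
    (hk : k ≤ 4) (g : SL(2, ℚ)) (hg : g.1 0 0 ≠ 0) :
    symMap y p (subst g (MvPolynomial.X 0 ^ k)) = (k.factorial : ℚ) • ρ g p := by
  obtain ⟨c, hc⟩ : ∃ c : ℚˣ, g.1 0 0 = c := ⟨Units.mk0 _ hg, rfl⟩
  have hc0 := c.ne_zero
  have h1 : ρ g p = ∑ l ∈ range (k + 1),
      ((c : ℚ) ^ k * ((g.1 1 0 / c) ^ l * (1 / (l.factorial : ℚ)))) • (y ^ l) p := by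
    conv_lhs => rw [eq_lower_mul_torus_mul_upper g c hc]
    rw [map_mul, map_mul, Module.End.mul_apply, Module.End.mul_apply, h.upper_apply_of_ker hx, hp c,
      map_smul, h.lower_apply, smul_sum, ← sum_subset (range_mono (show k + 1 ≤ 5 by omega))]
    · refine sum_congr rfl fun l _ => ?_
      rw [smul_smul, smul_smul, zpow_natCast, mul_assoc]
    · intro l _ hl
      rw [mem_range, not_lt] at hl
      rw [h.y_pow_eq_zero hp hx (by omega)]
      simp
  rw [h1, subst_X_zero_pow, map_sum, smul_sum]
  refine sum_congr rfl fun l hl => ?_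
  rw [mem_range] at hl
  rw [map_smul, symMap_mon, smul_smul, smul_smul, hc]
  congr 1
  have h2 : ((k.choose l : ℚ)) * l.factorial * (k - l).factorial = k.factorial := by
    exact_mod_cast Nat.choose_mul_factorial_mul_factorial (show l ≤ k by omega)
  have h3 : (c : ℚ) ^ k = (c : ℚ) ^ (k - l) * (c : ℚ) ^ l := by
    rw [← pow_add, Nat.sub_add_cancel (by omega)]
  have h4 : (l.factorial : ℚ) ≠ 0 := by exact_mod_cast l.factorial_ne_zero
  rw [h3, ← h2, div_pow]
  field_simp

/-- For all but at most one `b`, both `lower b` and `g * lower b` lie in the big cell, where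
`symMap_orbit` gives equivariance on the `lower b`-translate of `X ^ k`. Coefficients in `b` then
give every monomial. -/
lemma IsLogPair.symMap_equivariant (h : IsLogPair ρ x y) (hp : p ∈ weightSpace ρ k)
    (hx : x p = 0) (hk : k ≤ 4) (g : SL(2, ℚ)) {q : MvPolynomial (Fin 2) ℚ}
    (hq : q ∈ MvPolynomial.homogeneousSubmodule (Fin 2) ℚ k) :
    symMap y p (subst g q) = ρ g (symMap y p q) := by
  set D : MvPolynomial (Fin 2) ℚ →ₗ[ℚ] M :=
    symMap y p ∘ₗ (subst g).toLinearMap - ρ g ∘ₗ symMap y p with hD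
  suffices hle : MvPolynomial.homogeneousSubmodule (Fin 2) ℚ k ≤ LinearMap.ker D by
    have := LinearMap.mem_ker.1 (hle hq)
    rw [hD, LinearMap.sub_apply, sub_eq_zero] at this
    exact this
  rw [homogeneousSubmodule_eq_span, Submodule.span_le]
  rintro _ ⟨l, hl, rfl⟩
  have hl' : l < k + 1 := by simpa using hl
  have hinf : {b : ℚ | g.1 0 0 + b * g.1 0 1 ≠ 0}.Infinite := by
    by_cases h01 : g.1 0 1 = 0
    · have h00 : g.1 0 0 ≠ 0 := fun h00 => by
        have := g.2
        rw [Matrix.det_fin_two, h00, h01] at this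
        simp at this
      simpa [h01, h00] using Set.infinite_univ
    · refine (Set.finite_singleton (-g.1 0 0 / g.1 0 1)).infinite_compl.mono fun b hb hb' => ?_
      apply hb
      rw [Set.mem_singleton_iff, eq_div_iff h01]
      linarith
  have := coeff_mem_of_infinite (LinearMap.ker D) hinf (k + 1)
    (fun l => (k.choose l : ℚ) • mon (k - l) l) (fun b hb => by
      rw [← subst_lower_X_zero_pow, LinearMap.mem_ker, hD, LinearMap.sub_apply, sub_eq_zero]
      have h1 := h.symMap_orbit hp hx hk (g * lower b) (by
        simpa [coe_lower, Matrix.mul_apply, Fin.sum_univ_two, mul_comm] using hb)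
      have h2 := h.symMap_orbit hp hx hk (lower b) (by simp [coe_lower])
      rw [subst_mul, AlgHom.comp_apply] at h1
      change symMap y p (subst g _) = ρ g (symMap y p _)
      rw [h1, h2, map_smul, map_mul, Module.End.mul_apply]) hl'
  have hc : (k.choose l : ℚ) ≠ 0 := by
    exact_mod_cast (Nat.choose_pos (by omega)).ne'
  have := (LinearMap.ker D).smul_mem (k.choose l : ℚ)⁻¹ this
  rwa [inv_smul_smul₀ hc] at this

end Embedding

/-! ### Simplicity of the symmetric powers. -/

section Simple

instance isSimpleModule_symNat (k : ℕ) : IsSimpleModule QG (SymNat k) := by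
  have key : ∀ N : Submodule QG (SymNat k), N ≠ ⊥ → N = ⊤ := fun N hN => by
    let N' : Submodule ℚ (MvPolynomial (Fin 2) ℚ) :=
      (N.restrictScalars ℚ).map
        ((MvPolynomial.homogeneousSubmodule (Fin 2) ℚ k).subtype ∘ₗ
          (symNatRep k).asModuleEquiv.toLinearMap)
    have hle : N' ≤ MvPolynomial.homogeneousSubmodule (Fin 2) ℚ k := by
      rintro _ ⟨q, _, rfl⟩
      exact ((symNatRep k).asModuleEquiv q).2
    have hst : ∀ g, ∀ q ∈ N', subst g q ∈ N' := by
      rintro g _ ⟨q, hq, rfl⟩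
      refine ⟨MonoidAlgebra.of ℚ _ g • q, N.smul_mem _ hq, ?_⟩
      rw [LinearMap.comp_apply, LinearEquiv.coe_coe, Representation.asModuleEquiv_map_smul,
        Representation.asAlgebraHom_of]
      rfl
    have h0 : N' ≠ ⊥ := fun h0 => hN <| by
      rw [Submodule.eq_bot_iff]
      intro q hq
      have : (((symNatRep k).asModuleEquiv q : _) : MvPolynomial (Fin 2) ℚ) ∈ N' := ⟨q, hq, rfl⟩
      rw [h0, Submodule.mem_bot] at this
      exact (symNatRep k).asModuleEquiv.map_eq_zero_iff.1 (Subtype.ext this)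
    have htop := homogeneousSubmodule_le_of_stable k N' hle h0 hst
    rw [eq_top_iff]
    rintro q -
    obtain ⟨r, hr, hrq⟩ := htop ((symNatRep k).asModuleEquiv q).2
    have : r = q := (symNatRep k).asModuleEquiv.injective (Subtype.ext hrq)
    exact this ▸ hr
  have hne : Nontrivial (SymNat k) := by
    refine ⟨(symNatRep k).asModuleEquiv.symm ⟨mon (k - 0) 0, mon_mem k (by omega)⟩, 0, fun h => ?_⟩
    rw [LinearEquiv.map_eq_zero_iff] at h
    have : mon (k - 0) 0 = 0 := congrArg Subtype.val h
    rw [mon_eq_monomial] at this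
    exact one_ne_zero (MvPolynomial.monomial_eq_zero.1 this)
  exact { toIsSimpleOrder := { eq_bot_or_eq_top := fun N => or_iff_not_imp_left.2 (key N) } }

end Simple

/-! ### The series of partial sums of isotypic components. -/

section Chain

variable {R : Type*} [Ring R] {M : Type v} [AddCommGroup M] [Module R M]

/-- A quotient of a semisimple isotypic module is isomorphic to a direct sum of simple modules. -/
lemma exists_linearEquiv_directSum_of_surjective {C : Type*} [AddCommGroup C] [Module R C]
    [IsSemisimpleModule R C] {S : Type*} [AddCommGroup S] [Module R S]
    (hC : IsIsotypicOfType R C S) (g : C →ₗ[R] M) (hg : Function.Surjective g) :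
    ∃ I : Type v, Nonempty (M ≃ₗ[R] ⨁ _ : I, S) := by
  obtain ⟨K, hK⟩ := exists_isCompl (LinearMap.ker g)
  let e : M ≃ₗ[R] K := (g.quotKerEquivOfSurjective hg).symm.trans
    (Submodule.quotientEquivOfIsCompl _ K hK)
  have hss : IsSemisimpleModule R M := IsSemisimpleModule.congr e
  have hiso : IsIsotypicOfType R M S :=
    hC.of_injective (K.subtype ∘ₗ e.toLinearMap) (K.subtype_injective.comp e.injective)
  obtain ⟨I, ⟨f⟩⟩ := hiso.linearEquiv_finsupp
  classical exact ⟨I, ⟨f.trans (finsuppLEquivDirectSum R S I)⟩⟩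

/-- The partial sums of isotypic components form a finite series, after omitting repetitions. -/
lemma exists_series {V : Type v} [AddCommGroup V] [Module QG V] (n : ℕ) :
    ∃ (m : ℕ) (F : Fin (m + 1) → Submodule QG V),
      StrictMono F ∧ F 0 = ⊥ ∧ F (Fin.last m) = ⨆ k ∈ range n, isotypicComponent QG V (SymNat k) ∧
      ∀ i : Fin m, ∃ k : ℕ, k < n ∧ ∃ I : Type v,
        Nonempty (Factor (F i.castSucc) (F i.succ) ≃ₗ[QG] ⨁ _ : I, SymNat k) := by
  induction n with
  | zero => exact ⟨0, fun _ => ⊥, fun i j hij => by omega, rfl, by simp, fun i => i.elim0⟩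
  | succ n ih =>
    obtain ⟨m, F, hF, hF0, hFm, hfac⟩ := ih
    set C := isotypicComponent QG V (SymNat n)
    have hsup : ⨆ k ∈ range (n + 1), isotypicComponent QG V (SymNat k) = C ⊔ F (Fin.last m) := by
      rw [hFm, range_add_one, Finset.iSup_insert]
    -- A component adding nothing is skipped to keep the series strict; otherwise the new factor is
    -- a quotient of `C`.
    by_cases hC : C ≤ F (Fin.last m)
    · refine ⟨m, F, hF, hF0, by rw [hsup, sup_eq_right.2 hC], fun i => ?_⟩
      obtain ⟨k, hk, h⟩ := hfac i
      exact ⟨k, by omega, h⟩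
    · set B := C ⊔ F (Fin.last m) with hB
      refine ⟨m + 1, Fin.snoc (α := fun _ => Submodule QG V) F B, ?_, ?_, ?_, ?_⟩
      · rw [Fin.strictMono_iff_lt_succ]
        intro i
        induction i using Fin.lastCases with
        | last =>
          rw [Fin.succ_last, Fin.snoc_castSucc, Fin.snoc_last]
          exact lt_of_le_of_ne le_sup_right fun h => hC (by rw [h]; exact le_sup_left)
        | cast i =>
          rw [Fin.succ_castSucc, Fin.snoc_castSucc, Fin.snoc_castSucc]
          exact hF Fin.castSucc_lt_succ
      · rw [← Fin.castSucc_zero, Fin.snoc_castSucc, hF0]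
      · rw [Fin.snoc_last, hsup]
      · intro i
        induction i using Fin.lastCases with
        | last =>
          refine ⟨n, by omega, ?_⟩
          rw [Fin.succ_last, Fin.snoc_castSucc, Fin.snoc_last]
          refine exists_linearEquiv_directSum_of_surjective
            (IsIsotypicOfType.isotypicComponent QG V (SymNat n))
            (Submodule.mkQ _ ∘ₗ Submodule.inclusion (le_sup_left : C ≤ B)) ?_
          rintro ⟨⟨b, hb⟩⟩
          obtain ⟨c, hc, d, hd, rfl⟩ := Submodule.mem_sup.1 hb
          refine ⟨⟨c, hc⟩, ?_⟩
          rw [LinearMap.comp_apply]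
          refine (Submodule.Quotient.eq _).2 ?_
          rw [Submodule.submoduleOf, Submodule.mem_comap]
          have : -d ∈ F (Fin.last m) := neg_mem hd
          simpa using this
        | cast i =>
          obtain ⟨k, hk, h⟩ := hfac i
          refine ⟨k, by omega, ?_⟩
          rwa [Fin.succ_castSucc, Fin.snoc_castSucc, Fin.snoc_castSucc]

end Chain

/-! ### Exhaustion by isotypic components, and the theorem. -/

section Main

variable {V : Type v} [AddCommGroup V] [Module QG V] [Module ℚ V] [IsScalarTower ℚ QG V]

lemma ofModule'_apply (g : SL(2, ℚ)) (v : V) :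
    (Representation.ofModule' V : Representation ℚ SL(2, ℚ) V) g v =
      MonoidAlgebra.of ℚ _ g • v := rfl

lemma iSup_isotypicComponent {x y : Module.End ℚ V}
    (h : IsLogPair (Representation.ofModule' V : Representation ℚ SL(2, ℚ) V) x y) :
    ⨆ k ∈ range 5, isotypicComponent QG V (SymNat k) = ⊤ := by
  set S := ⨆ k ∈ range 5, isotypicComponent QG V (SymNat k)
  have hst : ∀ g, ∀ m ∈ S, (Representation.ofModule' V : Representation ℚ SL(2, ℚ) V) g m ∈ S :=
    fun g m hm => S.smul_mem _ hm
  suffices S.restrictScalars ℚ = ⊤ by simpa using this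
  refine h.eq_top_of_highest _ (fun m hm => ?_) (hst weyl) fun K p hp hx => ?_
  -- `y m` is the linear coefficient of `ρ (lower b) m`, so a group-stable subspace is `y`-stable.
  · have := coeff_mem_of_infinite (S.restrictScalars ℚ) Set.infinite_univ 5
      (fun l => (1 / (l.factorial : ℚ)) • (y ^ l) m) (fun b _ => by
        rw [← h.lower_apply]; exact hst _ m hm) (l := 1) (by norm_num)
    simpa using this
  · by_cases hK : 5 ≤ K
    · rw [h.eq_zero_of_five_le hp hx hK]
      exact zero_mem _
    · let f : SymNat K →ₗ[QG] V := MonoidAlgebra.equivariantOfLinearOfComm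
        (symMap y p ∘ₗ (MvPolynomial.homogeneousSubmodule (Fin 2) ℚ K).subtype ∘ₗ
          (symNatRep K).asModuleEquiv.toLinearMap) fun g q => by
        have h1 := h.symMap_equivariant hp hx (by omega) g ((symNatRep K).asModuleEquiv q).2
        rw [ofModule'_apply] at h1
        refine Eq.trans ?_ h1
        simp only [LinearMap.comp_apply, LinearEquiv.coe_coe]
        rw [← MonoidAlgebra.of_apply, Representation.asModuleEquiv_map_smul,
          Representation.asAlgebraHom_of]
        rfl
      have hf : LinearMap.range f ≤ S := by
        -- Simplicity of `SymNat K` makes the image either a copy of it or zero.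
        obtain hinj | h0 := LinearMap.injective_or_eq_zero (R := QG) (M := SymNat K) (N := V) f
        · refine le_trans (le_sSup ?_) (le_biSup (fun k => isotypicComponent QG V (SymNat k))
            (show K ∈ range 5 by simp; omega))
          exact ⟨(LinearEquiv.ofInjective f hinj).symm⟩
        · rw [h0, LinearMap.range_zero]
          exact bot_le
      have hfp : f ((symNatRep K).asModuleEquiv.symm ⟨mon (K - 0) 0, mon_mem K (by omega)⟩) =
          (K.factorial : ℚ) • p := symMap_mon y p K 0
      have hmem : (K.factorial : ℚ) • p ∈ S.restrictScalars ℚ := by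
        rw [← hfp]
        exact hf (LinearMap.mem_range_self _ _)
      have := (S.restrictScalars ℚ).smul_mem (K.factorial : ℚ)⁻¹ hmem
      rwa [inv_smul_smul₀ (by exact_mod_cast K.factorial_ne_zero)] at this

end Main

end SL2Mod

theorem mainTheorem6 {V : Type v} [AddCommGroup V] [Module SL2Mod.QG V]
    (hV : ∃ u : SL(2, ℚ), SL2Mod.IsUnipotent u ∧ u ≠ 1 ∧
      (Module.toAddMonoidEnd SL2Mod.QG V (MonoidAlgebra.of ℚ SL(2, ℚ) u) - 1) ^ 5 = 0) :
    ∃ (m : ℕ) (F : Fin (m + 1) → Submodule SL2Mod.QG V),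
      StrictMono F ∧ F 0 = ⊥ ∧ F (Fin.last m) = ⊤ ∧
      ∀ i : Fin m, ∃ k : ℕ, k ≤ 4 ∧ ∃ I : Type v,
        Nonempty (SL2Mod.Factor (F i.castSucc) (F i.succ)
          ≃ₗ[SL2Mod.QG] ⨁ _ : I, SL2Mod.SymNat k) := by
  let _ : Module ℚ V := Module.compHom V (algebraMap ℚ SL2Mod.QG)
  have _ : IsScalarTower ℚ SL2Mod.QG V := IsScalarTower.of_algebraMap_smul fun _ _ => rfl
  obtain ⟨u, hu, hu1, hu5⟩ := hV
  set ρ : Representation ℚ SL(2, ℚ) V := Representation.ofModule' V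
  have h5 : (ρ u - 1) ^ 5 = 0 := by
    -- The hypothesis lives in additive endomorphisms; it is transferred pointwise to `ℚ`-linear
    -- ones.
    have hpow : ∀ (n : ℕ) (v : V), ((ρ u - 1) ^ n) v =
        ((Module.toAddMonoidEnd SL2Mod.QG V (MonoidAlgebra.of ℚ SL(2, ℚ) u) - 1) ^ n) v := by
      intro n
      induction n with
      | zero => intro v; rfl
      | succ n ih =>
        intro v
        rw [pow_succ, pow_succ, Module.End.mul_apply, ih]
        rfl
    ext v
    rw [hpow, hu5]
    rfl
  obtain ⟨g, a, ha, hga⟩ := hu.exists_conj hu1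
  have ha5 : (ρ (SL2Mod.upper a) - 1) ^ 5 = 0 :=
    SL2Mod.unipotent_conj ρ (g := g⁻¹) (k := u)
      (by rw [eq_inv_mul_iff_mul_eq, ← mul_assoc, ← hga, mul_inv_cancel_right]) h5
  obtain ⟨x, y, h⟩ := SL2Mod.exists_isLogPair ρ (SL2Mod.unipotent_upper ρ ha ha5)
  obtain ⟨m, F, hF, hF0, hFm, hfac⟩ := SL2Mod.exists_series (V := V) 5
  refine ⟨m, F, hF, hF0, hFm.trans (SL2Mod.iSup_isotypicComponent h), fun i => ?_⟩
  obtain ⟨k, hk, hI⟩ := hfac i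
  exact ⟨k, by omega, hI⟩
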